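/- For an integer $n\ge 1$ let $H_m=\sum_{k=1}^m \frac1k$ be the $m$-th harmonic number, let $d_m=\mathrm{LCM}(1,\dots,m)$, and define $$S_n=\prod_{k=1}^n\ \prod_{i=0}^{\min(k-1,\,n-k)}\ \prod_{j=i+1}^{n-i}(n+k)^{\frac{2d_{2n}}{j}\binom{n}{i}^2},\qquad L_n=\frac{\log S_n}{d_{2n}},\qquad A_n=\sum_{i=0}^n\binom{n}{i}^2H_{n+i}.$$ Then, as $n\to\infty$, Euler's constant $\gamma=\lim_{N\to\infty}(H_N-\log N)$ satisfies $$\gamma=\frac{A_n-L_n}{\binom{2n}{n}}+O\left(2^{-6n}n^{-1/2}\right).$$ -/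

import Mathlib

open Filter Asymptotics

namespace EulerGamma

/-- `d n = LCM(1, …, n)`. -/
def d (n : ℕ) : ℕ := (Finset.Icc 1 n).lcm id

/-- The natural-number division in the exponents of `S` below is exact: `j ≤ n ≤ 2 n` there. -/
theorem dvd_two_mul_d {n j : ℕ} (hj : 1 ≤ j) (hjn : j ≤ n) : j ∣ 2 * d (2 * n) :=
  Dvd.dvd.mul_left
    (Finset.dvd_lcm (f := id) (Finset.mem_Icc.mpr ⟨hj, by omega⟩)) 2

/-- The positive integer
`S n = ∏_{k=1}^{n} ∏_{i=0}^{min(k-1,n-k)} ∏_{j=i+1}^{n-i} (n+k)^((2 d_{2n} / j) * C(n,i)^2)`. -/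
def S (n : ℕ) : ℕ :=
  ∏ k ∈ Finset.Icc 1 n, ∏ i ∈ Finset.Icc 0 (min (k - 1) (n - k)),
    ∏ j ∈ Finset.Icc (i + 1) (n - i), (n + k) ^ (2 * d (2 * n) / j * n.choose i ^ 2)

/-- `L n = log (S n) / d_{2n}`. -/
noncomputable def L (n : ℕ) : ℝ := Real.log (S n : ℝ) / (d (2 * n) : ℝ)

/-- `A n = ∑_{i=0}^{n} C(n,i)^2 H_{n+i}`, where `H_m` is the `m`-th harmonic number. -/
def A (n : ℕ) : ℚ := ∑ i ∈ Finset.Icc 0 n, (n.choose i : ℚ) ^ 2 * harmonic (n + i)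

end EulerGamma

namespace EulerGamma

open Finset Topology

/-! Let `r n t = n! / (t (t + 1) ⋯ (t + n))`, and let `G n t` be the integral of its square over
`[t, ∞)`. Partial fractions of the square (`sq_r_eq_sum`) have coefficients `b` at the double poles
and `a` at the simple ones, so summing `G n` over the integers `t ≥ n + 1` produces harmonic numbers
from `b` and logarithms of factorials from `a`. The moments `∑ a = 0` and `∑ i a = ∑ b = C(2n,n)`
remove the divergent terms and leave `C(2n,n) γ - A n + L n` (`tendsto_sum_G`, `L_eq`). The sum is
nonnegative. A telescoping majorant bounds it by `8 r n (n+1)² = 8 / ((2n+1) C(2n,n))²`; after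
division by `C(2n,n)`, the bound `4 ^ n ≤ 2 √n C(2n,n)` gives the stated rate. -/

theorem hasDerivAt_prod_inv (s : Finset ℕ) (x : ℝ) (hx : ∀ j ∈ s, x + j ≠ 0) :
    HasDerivAt (fun t : ℝ => ∏ j ∈ s, (t + j)⁻¹)
      (-(∏ j ∈ s, (x + j)⁻¹) * ∑ j ∈ s, (x + j)⁻¹) x := by
  have h := HasDerivAt.fun_finsetProd (u := s) (x := x) (f := fun (j : ℕ) (t : ℝ) => (t + j)⁻¹)
    (f' := fun j : ℕ => -1 / (x + j) ^ 2)
    (fun j hj => ((hasDerivAt_id x).add_const (j : ℝ)).fun_inv (hx j hj))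
  refine h.congr_deriv ?_
  rw [mul_sum]
  refine sum_congr rfl fun j hj => ?_
  rw [← mul_prod_erase s _ hj, smul_eq_mul]
  field_simp

/-! ### Partial fractions of `r n` and of its square -/

/-- The rational function `n! / (t (t + 1) ⋯ (t + n))`. -/
noncomputable def r (n : ℕ) (t : ℝ) : ℝ := n.factorial * ∏ j ∈ range (n + 1), (t + j)⁻¹

/-- The residue of `r n` at `-i`. -/
def c (n i : ℕ) : ℝ := (-1) ^ i * n.choose i

theorem r_succ (n : ℕ) (t : ℝ) (ht : ∀ j ∈ range (n + 2), t + j ≠ 0) :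
    r (n + 1) t = r n t - r n (t + 1) := by
  have h0 : t ≠ 0 := by simpa using ht 0 (by simp)
  have hn : t + (n + 1 : ℕ) ≠ 0 := ht (n + 1) (by simp)
  have e1 : r n t = n.factorial * (t⁻¹ * ∏ j ∈ range n, (t + (j + 1 : ℕ))⁻¹) := by
    rw [r, prod_range_succ', mul_comm (∏ j ∈ range n, _)]; simp
  have e2 : r n (t + 1) =
      n.factorial * ((∏ j ∈ range n, (t + (j + 1 : ℕ))⁻¹) * (t + (n + 1 : ℕ))⁻¹) := by
    rw [r, prod_range_succ]
    congr 2
    · exact prod_congr rfl fun j _ => by push_cast; ring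
    · push_cast; ring
  have e3 : r (n + 1) t = (n + 1) * n.factorial *
      (t⁻¹ * (∏ j ∈ range n, (t + (j + 1 : ℕ))⁻¹) * (t + (n + 1 : ℕ))⁻¹) := by
    rw [r, prod_range_succ, prod_range_succ', Nat.factorial_succ]
    push_cast
    simp only [add_zero]
    ring
  rw [e1, e2, e3]
  generalize (∏ j ∈ range n, (t + (j + 1 : ℕ))⁻¹) = P
  field_simp
  push_cast
  ring

theorem r_eq_sum (n : ℕ) (t : ℝ) (ht : ∀ j ∈ range (n + 1), t + j ≠ 0) :
    r n t = ∑ j ∈ range (n + 1), c n j * (t + j)⁻¹ := by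
  induction n generalizing t with
  | zero => simp [r, c]
  | succ n ih =>
    rw [r_succ n t ht, ih t fun j hj => ht j (by simp at hj ⊢; omega),
      ih (t + 1) fun j hj => by
        have := ht (j + 1) (by simp at hj ⊢; omega)
        push_cast at this
        rwa [add_assoc, add_comm 1 (j : ℝ)],
      sum_range_succ' (fun j => c (n + 1) j * (t + j)⁻¹)]
    have e1 : ∑ j ∈ range (n + 1), c n j * (t + j)⁻¹ =
        ∑ j ∈ range (n + 1), c n (j + 1) * (t + (j + 1 : ℕ))⁻¹ + c n 0 * (t + (0 : ℕ))⁻¹ := by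
      rw [← sum_range_succ' (fun j => c n j * (t + j)⁻¹), sum_range_succ _ (n + 1)]
      simp [c]
    have e0 : c (n + 1) 0 = c n 0 := by simp [c]
    rw [e1, e0, add_sub_right_comm, ← sum_sub_distrib]
    congr 1
    refine sum_congr rfl fun j _ => ?_
    have : t + 1 + (j : ℝ) = t + (j + 1 : ℕ) := by push_cast; ring
    rw [this]
    simp only [c, Nat.choose_succ_succ]
    push_cast
    ring

/-- Away from `-i`, `(t + i) r n t` equals both the product `g` without the factor `i` and `k = c n
i + (t + i) h t`. Both are differentiable at `-i`, so their derivatives agree there: logarithmic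
differentiation for `g`, the value `h (-i)` for `k`. -/
theorem sum_erase_residue (n i : ℕ) (hi : i ≤ n) :
    ∑ j ∈ (range (n + 1)).erase i, c n j * ((j : ℝ) - i)⁻¹ =
      -c n i * ∑ j ∈ (range (n + 1)).erase i, ((j : ℝ) - i)⁻¹ := by
  set s := (range (n + 1)).erase i with hs
  have hi' : i ∈ range (n + 1) := by simp; omega
  have hne : ∀ j ∈ s, -(i : ℝ) + j ≠ 0 := fun j hj h => by
    have : (j : ℝ) = i := by linarith
    exact (mem_erase.mp hj).1 (by exact_mod_cast this)
  set g : ℝ → ℝ := fun t => n.factorial * ∏ j ∈ s, (t + j)⁻¹ with hg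
  set h : ℝ → ℝ := fun t => ∑ j ∈ s, c n j * (t + j)⁻¹ with hh
  set k : ℝ → ℝ := fun t => c n i + (t + i) * h t with hk
  have dg : HasDerivAt g (g (-i) * -∑ j ∈ s, (-(i : ℝ) + j)⁻¹) (-i) := by
    refine ((hasDerivAt_prod_inv s (-(i : ℝ)) hne).const_mul (n.factorial : ℝ)).congr_deriv ?_
    simp only [hg]
    ring
  have dh : DifferentiableAt ℝ h (-i) := by
    refine DifferentiableAt.fun_sum fun j hj => ?_
    exact ((differentiableAt_fun_id.add_const (j : ℝ)).fun_inv (hne j hj)).const_mul _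
  have dk : HasDerivAt k (h (-i)) (-i) := by
    refine ((((hasDerivAt_id (-(i : ℝ))).add_const (i : ℝ)).fun_mul
      dh.hasDerivAt).const_add (c n i)).congr_deriv ?_
    simp
  have heq : g =ᶠ[𝓝[≠] (-(i : ℝ))] k := by
    have : ∀ᶠ t in 𝓝[≠] (-(i : ℝ)), ∀ j ∈ s, t + (j : ℝ) ≠ 0 := by
      refine Filter.Eventually.filter_mono nhdsWithin_le_nhds ?_
      rw [Filter.eventually_all_finset]
      exact fun j hj => (continuous_id.add_const (j : ℝ)).continuousAt.eventually_ne (hne j hj)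
    filter_upwards [this, self_mem_nhdsWithin] with t ht hti
    have hti' : t + (i : ℝ) ≠ 0 := fun h => hti (by simp; linarith)
    have e := r_eq_sum n t fun j hj => by
      by_cases hji : j = i
      · rw [hji]; exact hti'
      · exact ht j (mem_erase.mpr ⟨hji, hj⟩)
    rw [r, ← mul_prod_erase _ _ hi', ← add_sum_erase _ _ hi', ← hs] at e
    simp only [hg, hk, hh]
    rw [show (n.factorial : ℝ) * ∏ j ∈ s, (t + j)⁻¹ =
      (t + i) * (n.factorial * ((t + i)⁻¹ * ∏ j ∈ s, (t + j)⁻¹)) by field_simp, e, mul_add,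
      mul_left_comm, mul_inv_cancel₀ hti', mul_one]
  have heq' := (dg.continuousAt.eventuallyEq_nhds_iff_eventuallyEq_nhdsNE dk.continuousAt).mp heq
  have hgi : g (-i) = c n i := by rw [heq'.eq_of_nhds]; simp [hk]
  have := (dk.congr_of_eventuallyEq heq').unique dg
  rw [hgi] at this
  simp only [hh, neg_add_eq_sub] at this
  rw [this]; ring

theorem harmonic_eq (m : ℕ) : (harmonic m : ℝ) = ∑ k ∈ range m, ((k : ℝ) + 1)⁻¹ := by
  simp [harmonic]

theorem sum_erase_inv_sub (n i : ℕ) (hi : i ≤ n) :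
    ∑ j ∈ (range (n + 1)).erase i, ((j : ℝ) - i)⁻¹ = (harmonic (n - i) : ℝ) - harmonic i := by
  have h : ∑ j ∈ (range (n + 1)).erase i, ((j : ℝ) - i)⁻¹ =
      ∑ j ∈ range (n + 1), ((j : ℝ) - i)⁻¹ := sum_erase _ (by simp)
  obtain ⟨m, rfl⟩ := Nat.exists_eq_add_of_le hi
  rw [h, add_assoc, sum_range_add, sum_range_succ', harmonic_eq, harmonic_eq,
    ← sum_range_reflect (fun j : ℕ => ((j : ℝ) - i)⁻¹)]
  have e : ∀ j ∈ range i, (((i - 1 - j : ℕ) : ℝ) - i)⁻¹ = -((j : ℝ) + 1)⁻¹ := fun j hj => by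
    have : j + 1 ≤ i := mem_range.mp hj
    rw [Nat.sub_sub, Nat.cast_sub (by omega), ← inv_neg]
    congr 1; push_cast; ring
  rw [sum_congr rfl e]
  simp only [add_tsub_cancel_left, sum_neg_distrib, Nat.cast_add, Nat.cast_one, Nat.cast_zero]
  simp
  ring

/-- The coefficient of `1 / (t + i) ^ 2` in the partial fraction expansion of `r n t ^ 2`. -/
def b (n i : ℕ) : ℝ := (n.choose i : ℝ) ^ 2

/-- The coefficient of `1 / (t + i)` in the partial fraction expansion of `r n t ^ 2`. -/
noncomputable def a (n i : ℕ) : ℝ := 2 * (n.choose i : ℝ) ^ 2 * (harmonic i - harmonic (n - i))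

theorem sq_r_eq_sum (n : ℕ) (t : ℝ) (ht : 0 < t) :
    r n t ^ 2 = ∑ i ∈ range (n + 1), (b n i / (t + i) ^ 2 + a n i / (t + i)) := by
  have hp : ∀ i : ℕ, t + (i : ℝ) ≠ 0 := fun i => by positivity
  rw [r_eq_sum n t fun j _ => hp j, sq, sum_mul_sum]
  -- On the diagonal `(i - i)⁻¹ = 0` kills the first two terms, so one formula covers both cases.
  have key : ∀ i j : ℕ, c n i * (t + i)⁻¹ * (c n j * (t + j)⁻¹) =
      c n i * (t + i)⁻¹ * (c n j * ((j : ℝ) - i)⁻¹) + c n j * (t + j)⁻¹ * (c n i * ((i : ℝ) - j)⁻¹)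
        + if i = j then b n i / (t + i) ^ 2 else 0 := fun i j => by
    have hi := hp i
    have hj := hp j
    split_ifs with h
    · subst h
      have : (-1 : ℝ) ^ i * (-1) ^ i = 1 := by rw [← mul_pow]; simp
      simp only [sub_self, inv_zero, mul_zero, zero_add, c, b]
      field_simp
      linear_combination (n.choose i : ℝ) ^ 2 * this
    · have h1 : (i : ℝ) - j ≠ 0 := sub_ne_zero.mpr (by exact_mod_cast h)
      have h2 : (j : ℝ) - i ≠ 0 := sub_ne_zero.mpr (by exact_mod_cast Ne.symm h)
      have h3 : ((j : ℝ) - i)⁻¹ = -((i : ℝ) - j)⁻¹ := by rw [← inv_neg]; ring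
      rw [h3]
      field_simp
      ring
  simp only [key, sum_add_distrib]
  rw [sum_comm (f := fun i j : ℕ => c n j * (t + j)⁻¹ * (c n i * ((i : ℝ) - j)⁻¹))]
  have e1 : ∑ i ∈ range (n + 1), ∑ j ∈ range (n + 1),
      c n i * (t + i)⁻¹ * (c n j * ((j : ℝ) - i)⁻¹) =
      ∑ i ∈ range (n + 1), a n i / (t + i) / 2 := by
    refine sum_congr rfl fun i hi => ?_
    have hi' : i ≤ n := by simp at hi; omega
    rw [← mul_sum, ← sum_erase (a := i) _ (by simp), sum_erase_residue n i hi',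
      sum_erase_inv_sub n i hi']
    have : (-1 : ℝ) ^ i * (-1) ^ i = 1 := by rw [← mul_pow]; simp
    have := hp i
    simp only [c, a]
    field_simp
    linear_combination (n.choose i : ℝ) ^ 2 * ((harmonic i : ℝ) - harmonic (n - i)) *
      ‹(-1 : ℝ) ^ i * (-1) ^ i = 1›
  have e2 : ∑ i ∈ range (n + 1), ∑ j ∈ range (n + 1),
      (if i = j then b n i / (t + i) ^ 2 else 0) =
      ∑ i ∈ range (n + 1), b n i / (t + i) ^ 2 := by
    refine sum_congr rfl fun i hi => ?_
    rw [sum_ite_eq, if_pos hi]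
  rw [e1, e2, ← sum_div]
  ring

/-! ### Moments of the coefficients -/

theorem a_reflect (n i : ℕ) (hi : i ≤ n) : a n (n - i) = -a n i := by
  simp only [a, Nat.choose_symm hi, Nat.sub_sub_self hi]
  ring

theorem sum_a (n : ℕ) : ∑ i ∈ range (n + 1), a n i = 0 := by
  have h := sum_range_reflect (a n) (n + 1)
  rw [sum_congr rfl fun i hi => by
    rw [show n + 1 - 1 - i = n - i by omega, a_reflect n i (by simp at hi; omega)],
    sum_neg_distrib] at h
  linarith

theorem sum_b (n : ℕ) : ∑ i ∈ range (n + 1), b n i = ((2 * n).choose n : ℝ) := by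
  simp only [b]
  exact_mod_cast Nat.sum_range_choose_sq n

theorem r_pos (n : ℕ) {t : ℝ} (ht : 0 < t) : 0 < r n t := by
  rw [r]
  exact mul_pos (by positivity) (prod_pos fun j _ => by positivity)

theorem r_le (n : ℕ) {t : ℝ} (ht : 0 < t) : r n t ≤ n.factorial * (t⁻¹) ^ (n + 1) := by
  rw [r]
  refine mul_le_mul_of_nonneg_left ?_ (by positivity)
  refine (prod_le_prod (g := fun _ => t⁻¹) (fun j _ => by positivity) fun j _ => ?_).trans
    (by simp)
  exact inv_anti₀ ht (by linarith [(j.cast_nonneg : (0 : ℝ) ≤ j)])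

theorem tendsto_mul_r (n : ℕ) (hn : 1 ≤ n) : Tendsto (fun t => t * r n t) atTop (𝓝 0) := by
  have h : Tendsto (fun t : ℝ => (n.factorial : ℝ) * (t⁻¹) ^ n) atTop (𝓝 0) := by
    simpa [zero_pow (by omega : n ≠ 0)] using
      (tendsto_inv_atTop_zero.pow n).const_mul (n.factorial : ℝ)
  refine tendsto_of_tendsto_of_tendsto_of_le_of_le' tendsto_const_nhds h ?_ ?_
  · filter_upwards [eventually_gt_atTop 0] with t ht
    exact (mul_pos ht (r_pos n ht)).le
  · filter_upwards [eventually_gt_atTop 0] with t ht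
    refine (mul_le_mul_of_nonneg_left (r_le n ht) ht.le).trans_eq ?_
    rw [pow_succ]
    field_simp

theorem tendsto_div_add (x : ℝ) : Tendsto (fun t : ℝ => t / (t + x)) atTop (𝓝 1) := by
  have h : Tendsto (fun t : ℝ => 1 - x * (t + x)⁻¹) atTop (𝓝 (1 - x * 0)) :=
    ((tendsto_inv_atTop_zero.comp (tendsto_atTop_add_const_right _ x tendsto_id)).const_mul
      x).const_sub 1
  rw [mul_zero, sub_zero] at h
  refine h.congr' ?_
  filter_upwards [eventually_gt_atTop (-x)] with t ht
  have : t + x ≠ 0 := by linarith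
  field_simp
  ring

/-- The limit of `(t r n t)²` is `0` by decay and `∑ b - ∑ i a` by partial fractions; `∑ a = 0`
removes the term linear in `t`. -/
theorem sum_mul_a (n : ℕ) (hn : 1 ≤ n) :
    ∑ i ∈ range (n + 1), (i : ℝ) * a n i = ((2 * n).choose n : ℝ) := by
  rw [← sum_b]
  have h0 : Tendsto (fun t => (t * r n t) ^ 2) atTop (𝓝 0) := by
    simpa using (tendsto_mul_r n hn).pow 2
  have h1 : Tendsto (fun t : ℝ => ∑ i ∈ range (n + 1),
      (b n i * (t / (t + i)) ^ 2 - i * a n i * (t / (t + i)))) atTop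
      (𝓝 (∑ i ∈ range (n + 1), (b n i * 1 ^ 2 - i * a n i * 1))) :=
    tendsto_finsetSum _ fun i _ =>
      (((tendsto_div_add i).pow 2).const_mul _).sub ((tendsto_div_add i).const_mul _)
  have h2 : Tendsto (fun t => (t * r n t) ^ 2) atTop
      (𝓝 (∑ i ∈ range (n + 1), (b n i * 1 ^ 2 - i * a n i * 1))) := by
    refine h1.congr' ?_
    filter_upwards [eventually_gt_atTop 0] with t ht
    rw [mul_pow, sq_r_eq_sum n t ht, mul_sum, ← sub_eq_zero, ← sum_sub_distrib]
    have : ∀ i ∈ range (n + 1), b n i * (t / (t + i)) ^ 2 - i * a n i * (t / (t + i)) -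
        t ^ 2 * (b n i / (t + i) ^ 2 + a n i / (t + i)) = -t * a n i := fun i _ => by
      have : t + (i : ℝ) ≠ 0 := by positivity
      field_simp
      ring
    rw [sum_congr rfl this, ← mul_sum, sum_a, mul_zero]
  have h3 := tendsto_nhds_unique h0 h2
  rw [sum_sub_distrib] at h3
  simp only [one_pow, mul_one] at h3
  linarith

/-! ### The tail integral and its bounds -/

theorem hasDerivAt_r (n : ℕ) {x : ℝ} (hx : 0 < x) :
    HasDerivAt (r n) (-r n x * ∑ j ∈ range (n + 1), (x + j)⁻¹) x := by
  refine ((hasDerivAt_prod_inv (range (n + 1)) x fun j _ => by positivity).const_mul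
    (n.factorial : ℝ)).congr_deriv ?_
  simp only [r]
  ring

/-- The tail integral `∫_t^∞ r n x ^ 2 dx`, in closed form. -/
noncomputable def G (n : ℕ) (t : ℝ) : ℝ :=
  ∑ i ∈ range (n + 1), (b n i * (t + i)⁻¹ - a n i * Real.log (t + i))

theorem hasDerivAt_G (n : ℕ) {x : ℝ} (hx : 0 < x) : HasDerivAt (G n) (-(r n x) ^ 2) x := by
  have h : HasDerivAt (G n)
      (∑ i ∈ range (n + 1), (b n i * (-1 / (x + i) ^ 2) - a n i * (1 / (x + i)))) x := by
    refine HasDerivAt.fun_sum fun i _ => ?_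
    have hi : x + (i : ℝ) ≠ 0 := by positivity
    have hd : HasDerivAt (fun t : ℝ => t + (i : ℝ)) 1 x := (hasDerivAt_id x).add_const _
    exact ((hd.fun_inv hi).const_mul _).sub ((hd.log hi).const_mul _)
  refine h.congr_deriv ?_
  rw [sq_r_eq_sum n x hx, ← sum_neg_distrib]
  exact sum_congr rfl fun i _ => by ring

theorem tendsto_log_add_sub_log (x : ℝ) :
    Tendsto (fun t : ℝ => Real.log (t + x) - Real.log t) atTop (𝓝 0) := by
  have h := ((tendsto_div_add x).log one_ne_zero).neg
  rw [Real.log_one, neg_zero] at h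
  refine h.congr' ?_
  filter_upwards [eventually_gt_atTop 0, eventually_gt_atTop (-x)] with t h0 hx
  rw [Real.log_div h0.ne' (by linarith)]
  ring

theorem tendsto_G (n : ℕ) : Tendsto (G n) atTop (𝓝 0) := by
  have h : Tendsto (fun t : ℝ => ∑ i ∈ range (n + 1),
      (b n i * (t + i)⁻¹ - a n i * (Real.log (t + i) - Real.log t))) atTop
      (𝓝 (∑ i ∈ range (n + 1), (b n i * 0 - a n i * 0))) :=
    tendsto_finsetSum _ fun i _ =>
      ((tendsto_inv_atTop_zero.comp
        (tendsto_atTop_add_const_right _ (i : ℝ) tendsto_id)).const_mul _).sub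
      ((tendsto_log_add_sub_log i).const_mul _)
  simp only [mul_zero, sub_zero, sum_const_zero] at h
  refine h.congr fun t => ?_
  have : ∑ i ∈ range (n + 1), a n i * Real.log t = 0 := by rw [← sum_mul, sum_a, zero_mul]
  rw [G, ← sub_eq_zero, ← sum_sub_distrib, ← this]
  exact sum_congr rfl fun i _ => by ring

/-- A function on `[x, ∞)` with nonpositive derivative and limit `0` is nonnegative. -/
theorem nonneg_of_deriv_nonpos_of_tendsto {f f' : ℝ → ℝ} {x : ℝ}
    (hf : ∀ t, x ≤ t → HasDerivAt f (f' t) t) (hf' : ∀ t, x ≤ t → f' t ≤ 0)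
    (hlim : Tendsto f atTop (𝓝 0)) : 0 ≤ f x := by
  have anti : AntitoneOn f (Set.Ici x) := by
    refine antitoneOn_of_deriv_nonpos (convex_Ici x)
      (fun t ht => (hf t ht).continuousAt.continuousWithinAt)
      (fun t ht => (hf t (interior_subset ht)).differentiableAt.differentiableWithinAt)
      fun t ht => ?_
    rw [(hf t (interior_subset ht)).deriv]
    exact hf' t (interior_subset ht)
  refine le_of_tendsto hlim ?_
  filter_upwards [eventually_ge_atTop x] with t ht
  exact anti Set.self_mem_Ici ht ht

theorem G_nonneg (n : ℕ) {x : ℝ} (hx : 0 < x) : 0 ≤ G n x :=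
  nonneg_of_deriv_nonpos_of_tendsto (fun _ ht => hasDerivAt_G n (hx.trans_le ht))
    (fun t _ => neg_nonpos.mpr (sq_nonneg (r n t))) (tendsto_G n)

theorem tendsto_r (n : ℕ) (hn : 1 ≤ n) : Tendsto (r n) atTop (𝓝 0) := by
  have h := (tendsto_mul_r n hn).mul tendsto_inv_atTop_zero
  rw [zero_mul] at h
  refine h.congr' ?_
  filter_upwards [eventually_gt_atTop 0] with t ht
  field_simp

/-- The difference of the two sides tends to `0` and is decreasing: for `j ≤ n ≤ t` each `1 / (t +
j)` is at least `1 / (2t)`. -/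
theorem G_le (n : ℕ) (hn : 1 ≤ n) {x : ℝ} (hx : (n : ℝ) ≤ x) : G n x ≤ x / n * r n x ^ 2 := by
  have hn0 : (0 : ℝ) < n := by exact_mod_cast hn
  rw [← sub_nonneg]
  have hd : ∀ t, x ≤ t → HasDerivAt (fun t => t / n * r n t ^ 2 - G n t)
      (1 / n * r n t ^ 2 + t / n * (2 * r n t * (-r n t * ∑ j ∈ range (n + 1), (t + j)⁻¹))
        - -(r n t) ^ 2) t := fun t ht => by
    have ht0 : 0 < t := by linarith
    refine (((hasDerivAt_id t).div_const (n : ℝ)).fun_mul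
      ((hasDerivAt_r n ht0).fun_pow 2)).sub (hasDerivAt_G n ht0) |>.congr_deriv ?_
    simp
  refine nonneg_of_deriv_nonpos_of_tendsto (f := fun t => t / n * r n t ^ 2 - G n t) hd
    (fun t ht => ?_) ?_
  · have ht0 : 0 < t := by linarith
    have hs : ((n : ℝ) + 1) / (2 * t) ≤ ∑ j ∈ range (n + 1), (t + (j : ℝ))⁻¹ := by
      have := card_nsmul_le_sum (range (n + 1)) (fun j : ℕ => (t + (j : ℝ))⁻¹) (2 * t)⁻¹
        fun j hj => by
          have : (j : ℝ) ≤ n := by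
            have := mem_range.mp hj
            exact_mod_cast (by omega : j ≤ n)
          exact inv_anti₀ (by positivity) (by linarith)
      simpa [div_eq_mul_inv] using this
    rw [div_le_iff₀ (by positivity)] at hs
    have e : 1 / n * r n t ^ 2 +
        t / n * (2 * r n t * (-r n t * ∑ j ∈ range (n + 1), (t + (j : ℝ))⁻¹)) - -(r n t) ^ 2 =
        r n t ^ 2 / n *
          ((n : ℝ) + 1 - (∑ j ∈ range (n + 1), (t + (j : ℝ))⁻¹) * (2 * t)) := by
      field_simp
      ring
    rw [e]
    exact mul_nonpos_of_nonneg_of_nonpos (by positivity) (by linarith)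
  · have := (((tendsto_mul_r n hn).mul (tendsto_r n hn)).div_const (n : ℝ)).sub (tendsto_G n)
    simp only [mul_zero, zero_div, sub_zero] at this
    exact this.congr fun t => by ring

theorem r_add_one (n : ℕ) {t : ℝ} (ht : 0 < t) : r n (t + 1) * (t + n + 1) = t * r n t := by
  have e : ∏ j ∈ range n, (t + 1 + (j : ℝ))⁻¹ = ∏ j ∈ range n, (t + (j + 1 : ℕ))⁻¹ :=
    prod_congr rfl fun j _ => by push_cast; ring
  rw [r, r, prod_range_succ, prod_range_succ' (fun j : ℕ => (t + (j : ℝ))⁻¹), e]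
  have h1 : t + 1 + (n : ℝ) ≠ 0 := by positivity
  have h2 : t + (n : ℝ) + 1 ≠ 0 := by positivity
  generalize (∏ j ∈ range n, (t + (j + 1 : ℕ))⁻¹) = P
  simp only [Nat.cast_zero, add_zero]
  field_simp
  ring

/-- The recurrence for `r n (x + 1)` turns `G_le` into a telescoping bound. -/
theorem G_le_sub (n : ℕ) (hn : 1 ≤ n) {x : ℝ} (hx : (n : ℝ) + 1 ≤ x) :
    G n x ≤ 2 * (x / n * r n x) ^ 2 - 2 * ((x + 1) / n * r n (x + 1)) ^ 2 := by
  refine (G_le n hn (by linarith)).trans ?_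
  have hn0 : (0 : ℝ) < n := by exact_mod_cast hn
  have hx0 : 0 < x := by linarith
  have e : r n (x + 1) = x * r n x / (x + n + 1) := by
    rw [eq_div_iff (by positivity), r_add_one n hx0]
  have key : x / n ≤ 2 * (x / n) ^ 2 * (1 - ((x + 1) / (x + n + 1)) ^ 2) := by
    have h1 : (x + 1) / (x + n + 1) ≤ 1 := (div_le_one (by positivity)).mpr (by linarith)
    have h0 : 0 ≤ (x + 1) / (x + n + 1) := by positivity
    have h2 : n / (2 * x) ≤ 1 - (x + 1) / (x + n + 1) := by
      rw [show 1 - (x + 1) / (x + n + 1) = n / (x + n + 1) by field_simp; ring]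
      exact div_le_div_of_nonneg_left hn0.le (by positivity) (by linarith)
    have h3 : n / (2 * x) ≤ 1 - ((x + 1) / (x + n + 1)) ^ 2 := by nlinarith
    calc x / n = 2 * (x / n) ^ 2 * (n / (2 * x)) := by field_simp
      _ ≤ _ := mul_le_mul_of_nonneg_left h3 (by positivity)
  calc x / n * r n x ^ 2 ≤ 2 * (x / n) ^ 2 * (1 - ((x + 1) / (x + n + 1)) ^ 2) * r n x ^ 2 :=
        mul_le_mul_of_nonneg_right key (sq_nonneg _)
    _ = _ := by rw [e]; field_simp

theorem sum_G_le (n : ℕ) (hn : 1 ≤ n) (M : ℕ) :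
    ∑ m ∈ range M, G n (n + 1 + m) ≤ 8 * r n (n + 1) ^ 2 := by
  have hn1 : (1 : ℝ) ≤ n := by exact_mod_cast hn
  set W : ℕ → ℝ := fun m => 2 * (((n : ℝ) + 1 + m) / n * r n (n + 1 + m)) ^ 2 with hW
  have h : ∑ m ∈ range M, G n (n + 1 + m) ≤ ∑ m ∈ range M, (W m - W (m + 1)) := by
    refine sum_le_sum fun m _ => ?_
    have := G_le_sub n hn (x := n + 1 + m) (by linarith [(m.cast_nonneg : (0 : ℝ) ≤ m)])
    simpa only [hW, Nat.cast_add, Nat.cast_one, add_assoc] using this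
  rw [sum_range_sub'] at h
  have h1 : 0 ≤ W M := by positivity
  have h2 : W 0 ≤ 8 * r n (n + 1) ^ 2 := by
    have h3 : ((n : ℝ) + 1) / n ≤ 2 := (div_le_iff₀ (by linarith)).mpr (by linarith)
    have h4 : (((n : ℝ) + 1) / n) ^ 2 ≤ 2 ^ 2 := pow_le_pow_left₀ (by positivity) h3 2
    simp only [hW, Nat.cast_zero, add_zero, mul_pow]
    nlinarith [sq_nonneg (r n (n + 1))]
  linarith

theorem r_natCast_add_one (n : ℕ) : r n (n + 1) = ((2 * n + 1) * (2 * n).choose n : ℝ)⁻¹ := by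
  have h := Nat.ascFactorial_eq_prod_range (n + 1) (n + 1)
  have h2 := Nat.factorial_mul_ascFactorial n (n + 1)
  have h3 := Nat.add_choose_mul_factorial_mul_factorial n n
  rw [← two_mul] at h3
  rw [show n + (n + 1) = 2 * n + 1 by ring, Nat.factorial_succ, ← h3] at h2
  have hf : (n.factorial : ℝ) ≠ 0 := by positivity
  have hP : ∏ j ∈ range (n + 1), ((n : ℝ) + 1 + j) = ((n + 1).ascFactorial (n + 1) : ℝ) := by
    rw [h]; push_cast; rfl
  have h4 : (n.factorial : ℝ) * ((n + 1).ascFactorial (n + 1) : ℝ) =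
      (2 * n + 1) * ((2 * n).choose n * n.factorial * n.factorial) := by exact_mod_cast h2
  have h5 : ((n + 1).ascFactorial (n + 1) : ℝ) =
      (2 * n + 1) * (2 * n).choose n * n.factorial :=
    mul_left_cancel₀ hf (by rw [h4]; ring)
  have hC : ((2 * n).choose n : ℝ) ≠ 0 := by
    exact_mod_cast (Nat.choose_pos (by omega)).ne'
  rw [r, prod_inv_distrib, hP, h5]
  field_simp

/-! ### Summing the tail integrals over integers -/

theorem harmonic_add (k M : ℕ) :
    ∑ m ∈ range M, ((k : ℝ) + 1 + m)⁻¹ = (harmonic (k + M) : ℝ) - harmonic k := by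
  rw [harmonic_eq, harmonic_eq, sum_range_add, add_sub_cancel_left]
  exact sum_congr rfl fun m _ => by push_cast; ring

theorem log_factorial_add (k M : ℕ) :
    ∑ m ∈ range M, Real.log ((k : ℝ) + 1 + m) =
      Real.log (k + M).factorial - Real.log k.factorial := by
  induction M with
  | zero => simp
  | succ M ih =>
    rw [sum_range_succ, ih, ← add_assoc, Nat.factorial_succ, Nat.cast_mul,
      Real.log_mul (by positivity) (by positivity)]
    push_cast
    rw [show (k : ℝ) + M + 1 = k + 1 + M by ring]
    ring

theorem tendsto_harmonic_add_sub_log (k : ℕ) :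
    Tendsto (fun M : ℕ => (harmonic (k + M) : ℝ) - Real.log M) atTop
      (𝓝 Real.eulerMascheroniConstant) := by
  have h1 : Tendsto (fun M : ℕ => (harmonic (k + M) : ℝ) - Real.log (k + M : ℕ)) atTop
      (𝓝 Real.eulerMascheroniConstant) := by
    have := (tendsto_add_atTop_iff_nat k).mpr Real.tendsto_harmonic_sub_log
    simpa only [add_comm] using this
  have h2 := h1.add ((tendsto_log_add_sub_log k).comp tendsto_natCast_atTop_atTop)
  rw [add_zero] at h2
  refine h2.congr fun M => ?_
  simp only [Function.comp_apply]
  push_cast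
  rw [add_comm (M : ℝ) k]
  ring

theorem tendsto_log_factorial_add (n i : ℕ) :
    Tendsto (fun M : ℕ => Real.log (n + i + M).factorial - Real.log (n + M).factorial
      - i * Real.log M) atTop (𝓝 0) := by
  have h : Tendsto (fun M : ℕ => ∑ m ∈ range i, (Real.log (M + (n + 1 + m : ℕ)) - Real.log M))
      atTop (𝓝 (∑ _m ∈ range i, (0 : ℝ))) :=
    tendsto_finsetSum _ fun m _ =>
      (tendsto_log_add_sub_log (n + 1 + m : ℕ)).comp tendsto_natCast_atTop_atTop
  rw [sum_const_zero] at h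
  refine h.congr fun M => ?_
  have := log_factorial_add (n + M) i
  rw [show n + M + i = n + i + M by ring] at this
  rw [← this, sum_sub_distrib, sum_const, card_range, nsmul_eq_mul]
  congr 1
  exact sum_congr rfl fun m _ => by congr 1; push_cast; ring

theorem tendsto_sum_G (n : ℕ) (hn : 1 ≤ n) :
    Tendsto (fun M : ℕ => ∑ m ∈ range M, G n (n + 1 + m)) atTop
      (𝓝 (((2 * n).choose n : ℝ) * Real.eulerMascheroniConstant
        - ∑ i ∈ range (n + 1), b n i * harmonic (n + i)
        + ∑ i ∈ range (n + 1), a n i * Real.log (n + i).factorial)) := by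
  have h : Tendsto (fun M : ℕ => ∑ i ∈ range (n + 1),
      (b n i * (((harmonic (n + i + M) : ℝ) - Real.log M) - harmonic (n + i))
        - a n i * ((Real.log (n + i + M).factorial - Real.log (n + M).factorial
          - i * Real.log M) - Real.log (n + i).factorial))) atTop
      (𝓝 (∑ i ∈ range (n + 1), (b n i * (Real.eulerMascheroniConstant - harmonic (n + i))
        - a n i * (0 - Real.log (n + i).factorial)))) :=
    tendsto_finsetSum _ fun i _ =>
      (((tendsto_harmonic_add_sub_log (n + i)).sub_const _).const_mul _).sub
        (((tendsto_log_factorial_add n i).sub_const _).const_mul _)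
  convert h using 1
  · ext M
    have e : ∀ i : ℕ, ∑ m ∈ range M,
        (b n i * ((n : ℝ) + 1 + m + i)⁻¹ - a n i * Real.log ((n : ℝ) + 1 + m + i)) =
        b n i * ((harmonic (n + i + M) : ℝ) - harmonic (n + i)) -
          a n i * (Real.log (n + i + M).factorial - Real.log (n + i).factorial) := fun i => by
      rw [← harmonic_add, ← log_factorial_add, mul_sum, mul_sum, ← sum_sub_distrib]
      refine sum_congr rfl fun m _ => ?_
      rw [show (n : ℝ) + 1 + m + i = (n + i : ℕ) + 1 + m by push_cast; ring]
    simp only [G]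
    rw [sum_comm, sum_congr rfl fun i _ => e i, ← sub_eq_zero, ← sum_sub_distrib]
    -- The normalisations inserted to make each term converge cancel by the three moment identities.
    have h3 : ∑ i ∈ range (n + 1), (b n i * Real.log M - i * a n i * Real.log M
        - a n i * Real.log (n + M).factorial) = 0 := by
      rw [sum_sub_distrib, sum_sub_distrib, ← sum_mul, ← sum_mul, ← sum_mul, sum_b,
        sum_mul_a n hn, sum_a]
      ring
    rw [← h3]
    exact sum_congr rfl fun i _ => by ring
  · rw [← sum_b, sum_mul, ← sum_sub_distrib, ← sum_add_distrib]
    exact congrArg _ (sum_congr rfl fun i _ => by ring)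

/-! ### Identification of `A` and `L` -/

theorem A_eq (n : ℕ) : (A n : ℝ) = ∑ i ∈ range (n + 1), b n i * harmonic (n + i) := by
  rw [A, ← Nat.range_succ_eq_Icc_zero]
  push_cast
  rfl

theorem log_S (n : ℕ) : Real.log (S n) = ∑ k ∈ Icc 1 n, ∑ i ∈ Icc 0 (min (k - 1) (n - k)),
    ∑ j ∈ Icc (i + 1) (n - i),
      (2 * d (2 * n) / j * (n.choose i : ℝ) ^ 2) * Real.log (n + k) := by
  have hpos : ∀ k ∈ Icc 1 n, n + k ≠ 0 := fun k hk => by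
    have := (mem_Icc.mp hk).1
    omega
  have hj : ∀ k ∈ Icc 1 n, ∀ i : ℕ, ∏ j ∈ Icc (i + 1) (n - i),
      (n + k) ^ (2 * d (2 * n) / j * n.choose i ^ 2) ≠ 0 := fun k hk i =>
    prod_ne_zero_iff.mpr fun j _ => pow_ne_zero _ (hpos k hk)
  have hi : ∀ k ∈ Icc 1 n, ∏ i ∈ Icc 0 (min (k - 1) (n - k)), ∏ j ∈ Icc (i + 1) (n - i),
      (n + k) ^ (2 * d (2 * n) / j * n.choose i ^ 2) ≠ 0 := fun k hk =>
    prod_ne_zero_iff.mpr fun i _ => hj k hk i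
  rw [S, Nat.cast_prod, Real.log_prod fun k hk => Nat.cast_ne_zero.mpr (hi k hk)]
  refine sum_congr rfl fun k hk => ?_
  rw [Nat.cast_prod, Real.log_prod fun i _ => Nat.cast_ne_zero.mpr (hj k hk i)]
  refine sum_congr rfl fun i _ => ?_
  rw [Nat.cast_prod,
    Real.log_prod fun j _ => Nat.cast_ne_zero.mpr (pow_ne_zero _ (hpos k hk))]
  refine sum_congr rfl fun j hj => ?_
  obtain ⟨h1, h2⟩ := mem_Icc.mp hj
  rw [Nat.cast_pow, Real.log_pow, Nat.cast_mul,
    Nat.cast_div (dvd_two_mul_d (n := n) (by omega : 1 ≤ j) (by omega))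
      (by exact_mod_cast (by omega : j ≠ 0))]
  push_cast
  rfl

theorem d_ne_zero (n : ℕ) : d n ≠ 0 := by
  rw [d, Ne, Finset.lcm_eq_zero_iff]
  simp

theorem sum_Icc_inv (n i : ℕ) (hi : i ≤ n) (h : 2 * i ≤ n) :
    ∑ j ∈ Icc (i + 1) (n - i), (j : ℝ)⁻¹ = (harmonic (n - i) : ℝ) - harmonic i := by
  have := harmonic_add i (n - 2 * i)
  rw [show i + (n - 2 * i) = n - i by omega] at this
  rw [← this, ← Ico_add_one_right_eq_Icc, sum_Ico_eq_sum_range,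
    show n - i + 1 - (i + 1) = n - 2 * i by omega]
  exact sum_congr rfl fun m _ => by push_cast; ring

theorem L_eq_sum_neg_a (n : ℕ) : L n = ∑ k ∈ Icc 1 n,
    (∑ i ∈ range (min k (n - k + 1)), -a n i) * Real.log (n + k) := by
  have hd : (d (2 * n) : ℝ) ≠ 0 := by exact_mod_cast d_ne_zero _
  rw [L, log_S, sum_div]
  refine sum_congr rfl fun k hk => ?_
  obtain ⟨h1, h2⟩ := mem_Icc.mp hk
  rw [← Nat.range_succ_eq_Icc_zero, show min (k - 1) (n - k) + 1 = min k (n - k + 1) by omega,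
    sum_mul, sum_div]
  refine sum_congr rfl fun i hi => ?_
  have hi := mem_range.mp hi
  have : -a n i = 2 * (n.choose i : ℝ) ^ 2 * ∑ j ∈ Icc (i + 1) (n - i), (j : ℝ)⁻¹ := by
    -- The range of `i` forces `2 * i ≤ n`, so the interval of `j` is genuine.
    rw [sum_Icc_inv n i (by omega) (by omega), a]
    ring
  rw [this, mul_sum, sum_mul, sum_div]
  refine sum_congr rfl fun j _ => ?_
  field_simp

/-- Antisymmetry of `a n` makes the terms with `n - k < i < k` cancel. -/
theorem sum_range_min_a (n k : ℕ) (hk : k ≤ n) :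
    ∑ i ∈ range (min k (n - k + 1)), a n i = ∑ i ∈ range k, a n i := by
  rcases le_total k (n - k + 1) with h | h
  · rw [min_eq_left h]
  · obtain ⟨m, hm⟩ := Nat.exists_eq_add_of_le h
    have e := sum_range_add (a n) (n - k + 1) m
    rw [← hm] at e
    rw [min_eq_right h, e, left_eq_add]
    set f : ℕ → ℝ := fun x => a n (n - k + 1 + x) with hf
    have h2 := sum_range_reflect f m
    have h3 : ∀ x ∈ range m, f (m - 1 - x) = -f x := fun x hx => by
      have := mem_range.mp hx
      simp only [hf]
      rw [← a_reflect n _ (by omega)]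
      congr 1
      omega
    rw [sum_congr rfl h3, sum_neg_distrib] at h2
    have h4 : ∑ x ∈ range m, f x = 0 := by linarith
    exact h4

/-- Summation by parts: expand `log (n + i)!` over `log (n + k)`, `k ≤ i`, and swap sums; since `∑ a
= 0`, the tail `i ≥ k` is minus the head `i < k`. -/
theorem L_eq (n : ℕ) : L n = ∑ i ∈ range (n + 1), a n i * Real.log (n + i).factorial := by
  have h1 : ∀ i : ℕ, a n i * Real.log (n + i).factorial =
      a n i * Real.log n.factorial + ∑ m ∈ range i, a n i * Real.log (n + (m + 1 : ℕ)) :=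
    fun i => by
      rw [← mul_sum, ← mul_add, sub_eq_iff_eq_add'.mp (log_factorial_add n i).symm]
      congr 2
      exact sum_congr rfl fun m _ => by congr 1; push_cast; ring
  have h2 : ∀ k ∈ Icc 1 n, (∑ i ∈ range (min k (n - k + 1)), -a n i) * Real.log (n + k) =
      ∑ i ∈ Ico k (n + 1), a n i * Real.log (n + k) := fun k hk => by
    have hk := (mem_Icc.mp hk).2
    have := sum_range_add_sum_Ico (a n) (show k ≤ n + 1 by omega)
    rw [sum_a] at this
    rw [sum_neg_distrib, sum_range_min_a n k hk, ← sum_mul]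
    congr 1
    linarith
  rw [L_eq_sum_neg_a, sum_congr rfl h2, sum_congr rfl fun i _ => h1 i, sum_add_distrib,
    ← sum_mul, sum_a, zero_mul, zero_add]
  have h3 : ∀ i : ℕ, ∑ m ∈ range i, a n i * Real.log (n + (m + 1 : ℕ)) =
      ∑ k ∈ Ico 1 (i + 1), a n i * Real.log (n + k) := fun i => by
    rw [sum_Ico_eq_sum_range]
    exact sum_congr (by simp) fun m _ => by rw [add_comm 1 m]
  rw [sum_congr rfl fun i _ => h3 i]
  refine sum_comm' fun k i => ?_
  simp only [mem_Icc, mem_Ico, mem_range]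
  omega

/-! ### The error estimate -/

theorem error_bounds (n : ℕ) (hn : 1 ≤ n) :
    0 ≤ ((2 * n).choose n : ℝ) * Real.eulerMascheroniConstant - A n + L n ∧
      ((2 * n).choose n : ℝ) * Real.eulerMascheroniConstant - A n + L n ≤
        8 * r n (n + 1) ^ 2 := by
  have h := tendsto_sum_G n hn
  rw [← A_eq, ← L_eq] at h
  exact ⟨ge_of_tendsto' h fun M => sum_nonneg fun m _ => G_nonneg n (by positivity),
    le_of_tendsto' h (sum_G_le n hn)⟩

theorem pow_le_mul_sq_centralBinom (n : ℕ) (hn : 1 ≤ n) :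
    16 ^ n ≤ 4 * n * (2 * n).choose n ^ 2 := by
  rw [← Nat.centralBinom_eq_two_mul_choose]
  induction n, hn using Nat.le_induction with
  | base => simp [Nat.centralBinom, Nat.choose]
  | succ n hn ih =>
    have h := Nat.succ_mul_centralBinom_succ n
    have h2 : (n + 1) * 16 ^ (n + 1) ≤ (n + 1) * (4 * (n + 1) * (n + 1).centralBinom ^ 2) :=
      calc (n + 1) * 16 ^ (n + 1) = 16 * (n + 1) * 16 ^ n := by ring
        _ ≤ 16 * (n + 1) * (4 * n * n.centralBinom ^ 2) := Nat.mul_le_mul_left _ ih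
        _ ≤ 16 * ((2 * n + 1) ^ 2 * n.centralBinom ^ 2) := by
          rw [mul_assoc, ← mul_assoc (n + 1)]
          exact Nat.mul_le_mul_left _ (Nat.mul_le_mul_right _ (by nlinarith))
        _ = 4 * (2 * (2 * n + 1) * n.centralBinom) ^ 2 := by ring
        _ = _ := by rw [← h]; ring
    exact Nat.le_of_mul_le_mul_left h2 (by omega)

theorem pow_le_sqrt_mul_centralBinom (n : ℕ) (hn : 1 ≤ n) :
    (4 : ℝ) ^ n ≤ 2 * √n * (2 * n).choose n := by
  refine (pow_le_pow_iff_left₀ (by positivity) (by positivity) two_ne_zero).mp ?_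
  rw [mul_pow, mul_pow, Real.sq_sqrt (by positivity), ← pow_mul, mul_comm n 2, pow_mul]
  have := pow_le_mul_sq_centralBinom n hn
  norm_num
  exact_mod_cast this

theorem error_le (n : ℕ) (hn : 1 ≤ n) :
    ‖Real.eulerMascheroniConstant - ((A n : ℝ) - L n) / ((2 * n).choose n : ℝ)‖ ≤
      16 * ((64 ^ n)⁻¹ * (√n)⁻¹) := by
  obtain ⟨h0, h1⟩ := error_bounds n hn
  have hC : (0 : ℝ) < (2 * n).choose n := by exact_mod_cast Nat.choose_pos (by omega)
  have h4 := pow_le_sqrt_mul_centralBinom n hn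
  rw [r_natCast_add_one] at h1
  set C : ℝ := ((2 * n).choose n : ℝ)
  have hs : 0 < √(n : ℝ) := Real.sqrt_pos.mpr (by exact_mod_cast hn)
  have hsq : √(n : ℝ) ^ 2 = n := Real.sq_sqrt (by positivity)
  have e : Real.eulerMascheroniConstant - ((A n : ℝ) - L n) / C =
      (C * Real.eulerMascheroniConstant - A n + L n) / C := by field_simp; ring
  rw [e, Real.norm_of_nonneg (div_nonneg h0 hC.le), div_le_iff₀ hC]
  refine h1.trans ?_
  have h64 : (64 : ℝ) ^ n ≤ 8 * √n ^ 3 * C ^ 3 := by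
    calc (64 : ℝ) ^ n = (4 ^ n) ^ 3 := by rw [← pow_mul, mul_comm, pow_mul]; norm_num
      _ ≤ (2 * √n * C) ^ 3 := pow_le_pow_left₀ (by positivity) h4 3
      _ = _ := by ring
  have h5 : (2 * √(n : ℝ) ^ 2) ^ 2 ≤ (2 * (n : ℝ) + 1) ^ 2 := by
    rw [hsq]
    exact pow_le_pow_left₀ (by positivity) (by linarith) 2
  have h6 : 8 * ((64 : ℝ) ^ n * √n) ≤ 16 * C * ((2 * n + 1) * C) ^ 2 :=
    calc 8 * ((64 : ℝ) ^ n * √n) ≤ 8 * (8 * √n ^ 3 * C ^ 3 * √n) := by gcongr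
      _ = 16 * C ^ 3 * (2 * √(n : ℝ) ^ 2) ^ 2 := by ring
      _ ≤ 16 * C ^ 3 * (2 * n + 1) ^ 2 := by gcongr
      _ = _ := by ring
  rw [inv_pow, ← mul_inv, ← div_eq_mul_inv, ← div_eq_mul_inv, div_mul_eq_mul_div,
    div_le_div_iff₀ (by positivity) (by positivity)]
  exact h6

end EulerGamma

theorem theorem9 :
    (fun n : ℕ =>
        Real.eulerMascheroniConstant
          - ((EulerGamma.A n : ℝ) - EulerGamma.L n) / ((2 * n).choose n : ℝ))
      =O[atTop]
    (fun n : ℕ => (2 : ℝ) ^ (-(6 * (n : ℝ))) * (n : ℝ) ^ (-(1 / 2) : ℝ)) := by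
  refine IsBigO.of_bound 16 ?_
  filter_upwards [eventually_ge_atTop 1] with n hn
  refine (EulerGamma.error_le n hn).trans_eq ?_
  have h1 : (2 : ℝ) ^ (-(6 * (n : ℝ))) = (64 ^ n)⁻¹ := by
    rw [Real.rpow_neg (by norm_num), Real.rpow_mul (by norm_num), Real.rpow_natCast]
    norm_num
  have h2 : (n : ℝ) ^ (-(1 / 2) : ℝ) = (√n)⁻¹ := by
    rw [Real.rpow_neg (by positivity), Real.sqrt_eq_rpow]
  rw [h1, h2, Real.norm_of_nonneg (by positivity)]
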